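/- Let $R$ be an associative ring with unit and let $M$ be a left unital $R$-module. A submodule $N$ of $M$ is called small in $M$, written $N \ll M$, if for every submodule $K$ of $M$, $N + K = M$ implies $K = M$. Let $\operatorname{Rad}(M)$ denote the sum of all small submodules of $M$. A module $X$ has property $AB5^*$ if $N + \bigcap_{i \in I} X_i = \bigcap_{i \in I} (N + X_i)$ for every submodule $N$ of $X$ and every inverse system (that is, downward directed family) $\{X_i\}_{i \in I}$ of submodules of $X$. A submodule $K$ of $M$ is a weak supplement of a submodule $L$ in $M$ if $K + L = M$ and $K \cap L \ll M$. The Krull dimension of a module is defined by transfinite recursion: the zero module has Krull dimension $-1$, and for an ordinal $\alpha \ge 0$ a module $X$ has Krull dimension $\alpha$ if it does not have Krull dimension less than $\alpha$ and, for every descending chain $X_0 \supseteq X_1 \supseteq \cdots$ of submodules of $X$, all but finitely many of the factors $X_i/X_{i+1}$ have Krull dimension less than $\alpha$; $X$ is said to have Krull dimension if its Krull dimension is $-1$ or some ordinal $\alpha$. Suppose that the module $\operatorname{Rad}(M)$ has $AB5^*$ and that every small submodule of $M$ has Krull dimension. Then every submodule of $\operatorname{Rad}(M)$ that has a weak supplement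 in $M$ has Krull dimension. -/

import Mathlib

universe u v

/-- A submodule `N` of `M` is small in `M` (written `N ≪ M`) if `N + K = M` implies `K = M`
for every submodule `K` of `M`. -/
def IsSmallSubmodule {R : Type u} [Ring R] {M : Type v} [AddCommGroup M] [Module R M]
    (N : Submodule R M) : Prop :=
  ∀ K : Submodule R M, N ⊔ K = ⊤ → K = ⊤

/-- The radical `Rad(M)` of a module: the sum of all small submodules of `M`. -/
def moduleRad (R : Type u) [Ring R] (M : Type v) [AddCommGroup M] [Module R M] :
    Submodule R M :=
  sSup {N : Submodule R M | IsSmallSubmodule N}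

/-- `K` is a weak supplement of `L` in `M` if `K + L = M` and `K ∩ L ≪ M`. -/
def IsWeakSupplement {R : Type u} [Ring R] {M : Type v} [AddCommGroup M] [Module R M]
    (K L : Submodule R M) : Prop :=
  K ⊔ L = ⊤ ∧ IsSmallSubmodule (K ⊓ L)

/-- Property `AB5*`: for every submodule `N` and every inverse system `S` of submodules of `M`
(a downward directed family), `N + ⋂ S = ⋂ {N + A : A ∈ S}`. The equation holds trivially for
the empty family, whose intersection is `M`. -/
def HasAB5Star (R : Type u) [Ring R] (M : Type v) [AddCommGroup M] [Module R M] : Prop :=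
  ∀ (N : Submodule R M) (S : Set (Submodule R M)), DirectedOn (· ≥ ·) S →
    N ⊔ sInf S = ⨅ A ∈ S, N ⊔ A

/-- `KrullDimModLE R α M`: the (Gabriel-Rentschler, Gordon-Robson) Krull dimension of the
module `M` exists and is at most the ordinal `α`. By transfinite recursion on `α`: in every
descending chain `f 0 ⊇ f 1 ⊇ ...` of submodules of `M`, all but finitely many of the factors
`f i / f (i + 1)` have Krull dimension less than `α`, that is, they are zero (Krull dimension
`-1`) or have Krull dimension at most `β` for some ordinal `β < α`. -/
def KrullDimModLE (R : Type u) [Ring R] (α : Ordinal.{v}) (M : Type v) [AddCommGroup M]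
    [Module R M] : Prop :=
  ∀ f : ℕ → Submodule R M, Antitone f → ∃ n : ℕ, ∀ i : ℕ, n ≤ i →
    Subsingleton (f i ⧸ (f (i + 1)).submoduleOf (f i)) ∨
      ∃ β : Ordinal.{v}, ∃ _ : β < α,
        KrullDimModLE R β (f i ⧸ (f (i + 1)).submoduleOf (f i))
termination_by α

/-- The module `M` has Krull dimension, i.e. its Krull dimension exists. -/
def HasKrullDim (R : Type u) [Ring R] (M : Type v) [AddCommGroup M] [Module R M] : Prop :=
  ∃ α : Ordinal.{v}, KrullDimModLE R α M

/-! A module has Krull dimension exactly when its lattice of submodules contains no copy of `ℚ`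
(`hasKrullDim_iff_isScatteredOrder`). This condition is self-dual and passes through strictly
monotone maps.

Let `K` be a weak supplement of `L`. A submodule of `L` is controlled by its trace on `K ⊓ L`, which
is small and hence scattered, and by its image in `M ⧸ K`; so it suffices that `M ⧸ K` be scattered.
As an image of `Rad(M)`, this quotient has `AB5*` and equals its own radical, and its small
submodules lift to small submodules of `M` inside `L`, so they are scattered.

What remains is lattice theory. In the dual of the submodule lattice, small becomes essential,
`AB5*` becomes upper continuity, and the radical being everything says that the essential elements
have infimum `⊥`. `IsUpperContinuous.isScatteredOrder` then applies: a copy of `ℚ` would produce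
another one above some essential element. -/

/-! ### Scattered orders. -/

/-- A preorder is scattered if it contains no copy of the chain of rational numbers. -/
def IsScatteredOrder (α : Type*) [Preorder α] : Prop :=
  ∀ f : ℚ → α, ¬ StrictMono f

theorem exists_strictMono_rat_between {p q : ℚ} (h : p < q) :
    ∃ ψ : ℚ → ℚ, StrictMono ψ ∧ ∀ r, p < ψ r ∧ ψ r < q := by
  obtain ⟨a, ha⟩ := exists_between h
  obtain ⟨b, hb⟩ := exists_between ha.2
  have : Nontrivial (Set.Ioo p q) :=
    ⟨⟨⟨a, ha⟩, ⟨b, ha.1.trans hb.1, hb.2⟩, fun e => hb.1.ne (congrArg Subtype.val e)⟩⟩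
  obtain ⟨e⟩ := Order.embedding_from_countable_to_dense ℚ (Set.Ioo p q)
  exact ⟨fun r => e r, fun x y hxy => e.strictMono hxy, fun r => (e r).2⟩

theorem IsScatteredOrder.of_dual {α : Type*} [Preorder α] (h : IsScatteredOrder αᵒᵈ) :
    IsScatteredOrder α := fun f hf =>
  h (fun q => OrderDual.toDual (f (-q))) fun _ _ hpq => hf (neg_lt_neg hpq)

theorem IsScatteredOrder.of_strictMono {α β : Type*} [Preorder α] [Preorder β]
    (h : IsScatteredOrder β) {g : α → β} (hg : StrictMono g) : IsScatteredOrder α :=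
  fun f hf => h (g ∘ f) (hg.comp hf)

/-- If two monotone maps jointly reflect strict inequalities into scattered orders, then the
source is scattered. -/
theorem IsScatteredOrder.of_monotone_pair {α β γ : Type*} [PartialOrder α] [PartialOrder β]
    [PartialOrder γ] (hβ : IsScatteredOrder β) (hγ : IsScatteredOrder γ) {g : α → β} {k : α → γ}
    (hg : Monotone g) (hk : Monotone k)
    (hgk : ∀ ⦃x y : α⦄, x ≤ y → g x = g y → k x = k y → x = y) : IsScatteredOrder α := by
  intro f hf
  -- If `k` is not strict along the copy of `ℚ`, it is constant on some rational interval, and there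
  -- `g` must be strict.
  by_cases H : StrictMono (k ∘ f)
  · exact hγ _ H
  obtain ⟨p, q, hpq, hne⟩ : ∃ p q, p < q ∧ k (f p) = k (f q) := by
    by_contra! hcon
    exact H fun p q hpq => (hk (hf hpq).le).lt_of_ne (hcon p q hpq)
  obtain ⟨ψ, hψ, hψm⟩ := exists_strictMono_rat_between hpq
  have hc : ∀ r, k (f (ψ r)) = k (f p) := fun r =>
    le_antisymm (hne ▸ hk (hf (hψm r).2).le) (hk (hf (hψm r).1).le)
  refine hβ (fun r => g (f (ψ r))) fun r s hrs => ?_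
  have hlt := hf (hψ hrs)
  exact (hg hlt.le).lt_of_ne fun e => hlt.ne (hgk hlt.le e ((hc r).trans (hc s).symm))

/-! ### Deviation of intervals, and its existence in scattered orders. -/

/-- The deviation of the interval `[a, b]` exists and is at most `α`. -/
def DeviationLE {Λ : Type v} [Preorder Λ] (α : Ordinal.{v}) (a b : Λ) : Prop :=
  ∀ f : ℕ → Λ, Antitone f → (∀ i, a ≤ f i ∧ f i ≤ b) → ∃ n : ℕ, ∀ i : ℕ, n ≤ i →
    f i = f (i + 1) ∨ ∃ β : Ordinal.{v}, ∃ _ : β < α, DeviationLE β (f (i + 1)) (f i)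
termination_by α

theorem DeviationLE.mono {Λ : Type v} [Preorder Λ] {α β : Ordinal.{v}} {a a' b b' : Λ}
    (h : DeviationLE α a b) (hαβ : α ≤ β) (ha : a ≤ a') (hb : b' ≤ b) : DeviationLE β a' b' := by
  rw [DeviationLE] at h ⊢
  intro f hf hfm
  obtain ⟨n, hn⟩ := h f hf fun i => ⟨ha.trans (hfm i).1, (hfm i).2.trans hb⟩
  refine ⟨n, fun i hi => (hn i hi).imp_right ?_⟩
  rintro ⟨γ, hγ, h⟩
  exact ⟨γ, hγ.trans_le hαβ, h⟩

/-- An interval without deviation splits into two intervals without deviation. -/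
theorem exists_split_of_not_deviationLE {Λ : Type v} [PartialOrder Λ] {a b : Λ}
    (h : ∀ α : Ordinal.{v}, ¬ DeviationLE α a b) :
    ∃ c, (a ≤ c ∧ ∀ α : Ordinal.{v}, ¬ DeviationLE α a c) ∧
      (c ≤ b ∧ ∀ α : Ordinal.{v}, ¬ DeviationLE α c b) := by
  classical
  let d : Λ × Λ → Ordinal.{v} := fun p =>
    if H : ∃ α : Ordinal.{v}, DeviationLE α p.1 p.2 then H.choose else 0
  have hd : ∀ x y : Λ, (∃ α : Ordinal.{v}, DeviationLE α x y) → DeviationLE (⨆ p, d p) x y := by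
    intro x y H
    have hxy : DeviationLE (d (x, y)) x y := by
      simp only [d, dif_pos H]
      exact H.choose_spec
    exact hxy.mono (Ordinal.le_iSup d (x, y)) le_rfl le_rfl
  -- All deviations that exist are bounded by `⨆ p, d p`, so failure at its successor gives a chain
  -- with infinitely many steps having no deviation at all. Two of them, on either side of `f (i +
  -- 1)`, give the split.
  have h1 := h (Order.succ (⨆ p, d p))
  rw [DeviationLE] at h1
  push Not at h1
  obtain ⟨f, hf, hfm, hbad⟩ := h1
  have hbad' : ∀ n, ∃ i, n ≤ i ∧ ∀ α : Ordinal.{v}, ¬ DeviationLE α (f (i + 1)) (f i) := by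
    intro n
    obtain ⟨i, hi, -, hi2⟩ := hbad n
    exact ⟨i, hi, fun α hα => hi2 _ (Order.lt_succ _) (hd _ _ ⟨α, hα⟩)⟩
  obtain ⟨i, -, hi⟩ := hbad' 0
  obtain ⟨j, hij, hj⟩ := hbad' (i + 1)
  refine ⟨f (i + 1), ⟨(hfm _).1, fun α hα => hj α ?_⟩, (hfm _).2, fun α hα => hi α ?_⟩
  · exact hα.mono le_rfl (hfm _).1 (hf hij)
  · exact hα.mono le_rfl le_rfl (hfm _).2

/-- A relation contained in the strict order, stable under enlarging intervals and having
midpoints, forces a copy of the rationals as soon as it is nonempty. -/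
theorem exists_strictMono_rat_of_split {Λ : Type*} [PartialOrder Λ] (r : Λ → Λ → Prop)
    (hlt : ∀ a b, r a b → a < b) (htrans : ∀ a b c, r a b → r b c → r a c)
    (hsplit : ∀ a b, r a b → ∃ c, r a c ∧ r c b) {a b : Λ} (hab : r a b) :
    ∃ f : ℚ → Λ, StrictMono f := by
  classical
  have hpair : IsChain r ({a, b} : Set Λ) := by
    rintro x (rfl | rfl) y (rfl | rfl) hxy
    · exact absurd rfl hxy
    · exact Or.inl hab
    · exact Or.inr hab
    · exact absurd rfl hxy
  obtain ⟨C, hC, habC⟩ := hpair.exists_maxChain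
  have hr : ∀ x y : C, x < y → r x y := fun x y hxy =>
    (hC.1 x.2 y.2 (fun e => hxy.ne (Subtype.ext e))).resolve_right
      fun h => (hlt _ _ h).not_gt hxy
  let : LinearOrder C :=
    { (inferInstance : PartialOrder C) with
      le_total := fun x y => by
        by_cases e : (x : Λ) = y
        · exact Or.inl e.le
        · exact (hC.1 x.2 y.2 e).imp (fun h => (hlt _ _ h).le) fun h => (hlt _ _ h).le
      toDecidableLE := Classical.decRel _ }
  have : Nontrivial C :=
    ⟨⟨a, habC (by simp)⟩, ⟨b, habC (by simp)⟩, fun e => (hlt _ _ hab).ne (congrArg Subtype.val e)⟩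
  have : DenselyOrdered C := by
    refine ⟨fun x y hxy => ?_⟩
    obtain ⟨c, hxc, hcy⟩ := hsplit _ _ (hr x y hxy)
    -- If nothing in `C` lay strictly between `x` and `y`, the midpoint `c` could be added to the
    -- maximal chain.
    by_contra! hno
    have hins : IsChain r (insert c C) := by
      refine hC.1.insert fun z hz _ => ?_
      rcases le_or_gt (⟨z, hz⟩ : C) x with hzx | hxz
      · rcases hzx.eq_or_lt with e | hl
        · exact Or.inr (by rw [← e] at hxc; exact hxc)
        · exact Or.inr (htrans _ _ _ (hr _ _ hl) hxc)
      · rcases (hno _ hxz).eq_or_lt with e | hl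
        · exact Or.inl (by rw [e] at hcy; exact hcy)
        · exact Or.inl (htrans _ _ _ hcy (hr _ _ hl))
    have hcC : c ∈ C := by
      rw [hC.2 hins (Set.subset_insert _ _)]
      exact Set.mem_insert _ _
    exact (hno ⟨c, hcC⟩ (hlt _ _ hxc)).not_gt (hlt _ _ hcy)
  obtain ⟨e⟩ := Order.embedding_from_countable_to_dense ℚ C
  exact ⟨fun q => e q, fun x y hxy => e.strictMono hxy⟩

theorem IsScatteredOrder.exists_deviationLE {Λ : Type v} [PartialOrder Λ]
    (h : IsScatteredOrder Λ) {a b : Λ} (hab : a ≤ b) : ∃ α : Ordinal.{v}, DeviationLE α a b := by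
  by_contra! hcon
  obtain ⟨f, hf⟩ := exists_strictMono_rat_of_split
    (fun x y : Λ => x ≤ y ∧ ∀ α : Ordinal.{v}, ¬ DeviationLE α x y)
    (fun x y hxy => hxy.1.lt_of_ne (by
      rintro rfl
      apply hxy.2 0
      rw [DeviationLE]
      exact fun f _ hfm => ⟨0, fun i _ => Or.inl
        ((le_antisymm (hfm i).2 (hfm i).1).trans (le_antisymm (hfm _).1 (hfm _).2))⟩))
    (fun x y z hxy hyz => ⟨hxy.1.trans hyz.1, fun α hα => hxy.2 α (hα.mono le_rfl le_rfl hyz.1)⟩)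
    (fun x y hxy => exists_split_of_not_deviationLE hxy.2) ⟨hab, hcon⟩
  exact h f hf

/-! ### Krull dimension versus scattered submodule lattices. -/

theorem Submodule.strictMono_map_subtype_comap_mkQ {R : Type u} [Ring R] {X : Type v}
    [AddCommGroup X] [Module R X] (A B : Submodule R X) :
    StrictMono fun T : Submodule R (B ⧸ A.submoduleOf B) =>
      (T.comap (A.submoduleOf B).mkQ).map B.subtype := by
  intro S T hST
  have h1 : S.comap (A.submoduleOf B).mkQ < T.comap (A.submoduleOf B).mkQ :=
    (Submodule.comap_strictMono_of_surjective (Submodule.mkQ_surjective _)) hST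
  exact (Submodule.map_strictMono_of_injective B.injective_subtype) h1

theorem Submodule.map_subtype_comap_mkQ_mem_Icc {R : Type u} [Ring R] {X : Type v}
    [AddCommGroup X] [Module R X] {A B : Submodule R X} (hAB : A ≤ B)
    (T : Submodule R (B ⧸ A.submoduleOf B)) :
    A ≤ (T.comap (A.submoduleOf B).mkQ).map B.subtype ∧
      (T.comap (A.submoduleOf B).mkQ).map B.subtype ≤ B := by
  refine ⟨fun x hx => ?_, Submodule.map_subtype_le _ _⟩
  refine ⟨⟨x, hAB hx⟩, ?_, rfl⟩
  have : (A.submoduleOf B).mkQ ⟨x, hAB hx⟩ = 0 :=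
    (Submodule.Quotient.mk_eq_zero _).2 hx
  simp only [SetLike.mem_coe, Submodule.mem_comap, this, T.zero_mem]

/-- Factors of a chain in `Y` are new modules, not submodules of `X`. The induction therefore varies
`Y` and remembers only a strictly monotone map into the interval. -/
theorem krullDimModLE_of_deviationLE {R : Type u} [Ring R] {X : Type v} [AddCommGroup X]
    [Module R X] (α : Ordinal.{v}) :
    ∀ (a b : Submodule R X), DeviationLE α a b → ∀ (Y : Type v) [AddCommGroup Y] [Module R Y]
      (Φ : Submodule R Y → Submodule R X), StrictMono Φ → (∀ T, a ≤ Φ T ∧ Φ T ≤ b) →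
      KrullDimModLE R α Y := by
  induction α using WellFoundedLT.induction with
  | ind α ih =>
    intro a b hab Y _ _ Φ hΦ hm
    rw [KrullDimModLE]
    intro g hg
    rw [DeviationLE] at hab
    obtain ⟨n, hn⟩ := hab (fun i => Φ (g i)) (hΦ.monotone.comp_antitone hg) fun i => hm _
    refine ⟨n, fun i hi => ?_⟩
    have hle := hg i.le_succ
    rcases hn i hi with he | ⟨β, hβ, hd⟩
    · left
      have hgi : g (i + 1) = g i := by
        by_contra hne
        exact (hΦ (lt_of_le_of_ne hle hne)).ne he.symm
      rw [Submodule.Quotient.subsingleton_iff, hgi]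
      exact Submodule.submoduleOf_self _
    · right
      refine ⟨β, hβ, ih β hβ _ _ hd _
        (fun T => Φ ((T.comap ((g (i + 1)).submoduleOf (g i)).mkQ).map (g i).subtype))
        (hΦ.comp (Submodule.strictMono_map_subtype_comap_mkQ _ _)) fun T => ?_⟩
      have := Submodule.map_subtype_comap_mkQ_mem_Icc hle T
      exact ⟨hΦ.monotone this.1, hΦ.monotone this.2⟩

theorem hasKrullDim_of_isScatteredOrder {R : Type u} [Ring R] {X : Type v} [AddCommGroup X]
    [Module R X] (h : IsScatteredOrder (Submodule R X)) : HasKrullDim R X := by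
  obtain ⟨α, hα⟩ := h.exists_deviationLE (bot_le : (⊥ : Submodule R X) ≤ ⊤)
  exact ⟨α, krullDimModLE_of_deviationLE α ⊥ ⊤ hα X id strictMono_id
    fun T => ⟨bot_le, le_top⟩⟩

/-- Along the chain `f (-i)` some factor is zero or of smaller dimension, yet the rationals between
`-(n + 1)` and `-n` put a copy of `ℚ` in its submodule lattice. -/
theorem KrullDimModLE.isScatteredOrder {R : Type u} [Ring R] (α : Ordinal.{v}) :
    ∀ (X : Type v) [AddCommGroup X] [Module R X], KrullDimModLE R α X →
      IsScatteredOrder (Submodule R X) := by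
  induction α using WellFoundedLT.induction with
  | ind α ih =>
    intro X _ _ h f hf
    rw [KrullDimModLE] at h
    obtain ⟨n, hn⟩ := h (fun i => f (-(i : ℚ)))
      (fun i j hij => hf.monotone (neg_le_neg (by exact_mod_cast hij)))
    have hlt : (-((n + 1 : ℕ) : ℚ)) < -(n : ℚ) := neg_lt_neg (by push_cast; linarith)
    obtain ⟨ψ, hψ, hψm⟩ := exists_strictMono_rat_between hlt
    set A := f (-((n + 1 : ℕ) : ℚ))
    set B := f (-(n : ℚ))
    have hF : StrictMono fun q => ((f (ψ q)).submoduleOf B).map (A.submoduleOf B).mkQ := by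
      intro p q hpq
      have key : ∀ r, (((f (ψ r)).submoduleOf B).map (A.submoduleOf B).mkQ).comap
          (A.submoduleOf B).mkQ = (f (ψ r)).submoduleOf B := by
        intro r
        rw [Submodule.comap_map_mkQ, sup_eq_right]
        exact Submodule.comap_mono (hf (hψm r).1).le
      have h0 := hf (hψ hpq)
      refine lt_of_le_of_ne (Submodule.map_mono (Submodule.comap_mono h0.le)) fun e => ?_
      have h1 := congrArg (Submodule.comap (A.submoduleOf B).mkQ) e
      simp only [key] at h1
      have h2 := congrArg (Submodule.map B.subtype) h1
      simp only [Submodule.submoduleOf, Submodule.map_comap_subtype] at h2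
      rw [inf_eq_right.2 (hf (hψm p).2).le, inf_eq_right.2 (hf (hψm q).2).le] at h2
      exact h0.ne h2
    rcases hn n le_rfl with hs | ⟨β, hβ, hd⟩
    · have : Subsingleton (B ⧸ A.submoduleOf B) := hs
      exact (hF zero_lt_one).ne (Subsingleton.elim _ _)
    · exact ih β hβ _ hd _ hF

theorem hasKrullDim_iff_isScatteredOrder {R : Type u} [Ring R] {X : Type v} [AddCommGroup X]
    [Module R X] : HasKrullDim R X ↔ IsScatteredOrder (Submodule R X) :=
  ⟨fun ⟨α, h⟩ => h.isScatteredOrder α X, hasKrullDim_of_isScatteredOrder⟩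

/-! ### Essential elements in upper continuous modular lattices. -/

/-- `e` is essential below `b`: it meets every nonzero element below `b` nontrivially. -/
def IsEssentialBelow {Λ : Type*} [Lattice Λ] [OrderBot Λ] (e b : Λ) : Prop :=
  ∀ y ≤ b, Disjoint y e → y = ⊥

/-- Upper continuity of a complete lattice (the condition `AB5`). -/
def IsUpperContinuous (Λ : Type*) [CompleteLattice Λ] : Prop :=
  ∀ (a : Λ) (S : Set Λ), DirectedOn (· ≤ ·) S → a ⊓ sSup S = ⨆ b ∈ S, a ⊓ b

namespace IsEssentialBelow

variable {Λ : Type*} [Lattice Λ] [OrderBot Λ]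

theorem inf_of_top {Λ : Type*} [Lattice Λ] [BoundedOrder Λ] {e : Λ} (h : IsEssentialBelow e ⊤)
    (x : Λ) : IsEssentialBelow (e ⊓ x) x := fun y hy hd =>
  h y le_top (disjoint_iff.2 (by
    rw [← disjoint_iff.1 hd, ← inf_assoc, inf_right_comm, inf_eq_left.2 hy]))

theorem trans {a b c : Λ} (hab : IsEssentialBelow a b) (hbc : IsEssentialBelow b c) :
    IsEssentialBelow a c := fun y hy hd =>
  hbc y hy (disjoint_iff.2 (hab _ inf_le_right ((hd.mono_left inf_le_left))))

theorem sup_right [IsModularLattice Λ] {a b c : Λ} (h : IsEssentialBelow a b) (hab : a ≤ b)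
    (hbc : Disjoint b c) : IsEssentialBelow (a ⊔ c) (b ⊔ c) := by
  intro y hy hd
  have h1 : Disjoint a (c ⊔ y) :=
    (hbc.mono_left hab).disjoint_sup_right_of_disjoint_sup_left hd.symm
  have h2 : Disjoint b (c ⊔ y) := disjoint_iff.2
    (h _ inf_le_left (h1.symm.mono_left inf_le_right))
  have h3 : Disjoint (b ⊔ c) y := by
    refine Disjoint.disjoint_sup_left_of_disjoint_sup_right ?_ h2
    exact (hd.mono_right le_sup_right).symm
  exact h3.symm.eq_bot_of_le hy

theorem sup [IsModularLattice Λ] {a b a' b' : Λ} (h : IsEssentialBelow a b) (hab : a ≤ b)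
    (h' : IsEssentialBelow a' b') (hab' : a' ≤ b') (hd : Disjoint b b') :
    IsEssentialBelow (a ⊔ a') (b ⊔ b') := by
  have h1 := h'.sup_right hab' (hd.symm.mono_right hab)
  rw [sup_comm a' a, sup_comm b' a] at h1
  exact h1.trans (h.sup_right hab hd)

end IsEssentialBelow

namespace IsUpperContinuous

variable {Λ : Type*} [CompleteLattice Λ]

theorem inf_iSup_eq_of_monotone (h : IsUpperContinuous Λ) (a : Λ) {s : ℕ → Λ}
    (hs : Monotone s) : a ⊓ ⨆ n, s n = ⨆ n, a ⊓ s n := by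
  have := h a (Set.range s) (directedOn_range.2 hs.directed_le)
  rwa [sSup_range, iSup_range] at this

theorem isEssentialBelow_iSup (h : IsUpperContinuous Λ) {a b : ℕ → Λ}
    (hb : Monotone b) (hab : ∀ n, IsEssentialBelow (a n) (b n)) :
    IsEssentialBelow (⨆ n, a n) (⨆ n, b n) := by
  intro y hy hd
  rw [← inf_eq_left.2 hy, h.inf_iSup_eq_of_monotone y hb, iSup_eq_bot]
  exact fun n => hab n _ inf_le_right (hd.mono inf_le_left (le_iSup a n))

/-- Every element `b` has a pseudocomplement, and `b ⊔ c` is then essential. -/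
theorem exists_disjoint_isEssentialBelow_sup [IsModularLattice Λ] (h : IsUpperContinuous Λ)
    (b : Λ) : ∃ c, Disjoint c b ∧ IsEssentialBelow (b ⊔ c) ⊤ := by
  obtain ⟨c, hc⟩ := zorn_le₀ {c : Λ | Disjoint c b} fun C hC hchain => by
    refine ⟨sSup C, ?_, fun z hz => le_sSup hz⟩
    rw [Set.mem_ofPred_eq, disjoint_comm, disjoint_iff, h b C hchain.directedOn]
    simp only [iSup_eq_bot]
    exact fun x hx => (disjoint_iff.1 (hC hx).symm)
  refine ⟨c, hc.1, fun y _ hd => ?_⟩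
  have h1 : Disjoint b (c ⊔ y) :=
    hc.1.symm.disjoint_sup_right_of_disjoint_sup_left hd.symm
  have h2 : c ⊔ y ≤ c := hc.2 h1.symm le_sup_left
  exact hd.eq_bot_of_le ((le_sup_right.trans h2).trans le_sup_right)

/-- If every essential element has a scattered upper interval and the essential elements have
infimum `⊥`, then a decreasing sequence is eventually essential in each of its terms. -/
theorem exists_isEssentialBelow_of_antitone [IsModularLattice Λ] (h : IsUpperContinuous Λ)
    (hess : ∀ e : Λ, IsEssentialBelow e ⊤ → IsScatteredOrder (Set.Ici e))
    (hinf : sInf {e : Λ | IsEssentialBelow e ⊤} = ⊥) {f : ℕ → Λ} (hf : Antitone f) :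
    ∃ m, ∀ n, m ≤ n → IsEssentialBelow (f n) (f m) := by
  -- Otherwise a subsequence `F` has nonzero `x k ≤ F k` disjoint from `F (k + 1)`. These `x k` are
  -- independent, and each has an essential `e k` strictly below it.
  by_contra! hcon
  choose next hnext hnot using hcon
  let t : ℕ → ℕ := fun k => next^[k] 0
  have ht : ∀ k, t (k + 1) = next (t k) := fun k => Function.iterate_succ_apply' _ _ _
  let F : ℕ → Λ := fun k => f (t k)
  have hF : Antitone F := antitone_nat_of_succ_le fun k => by
    simp only [F, ht]
    exact hf (hnext _)
  have hx : ∀ k, ∃ x, x ≤ F k ∧ Disjoint x (F (k + 1)) ∧ x ≠ ⊥ := by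
    intro k
    have := hnot (t k)
    rw [← ht] at this
    unfold IsEssentialBelow at this
    push Not at this
    exact this
  choose x hxF hxd hx0 using hx
  have he : ∀ k, ∃ e, e ≤ x k ∧ ¬ x k ≤ e ∧ IsEssentialBelow e (x k) := by
    intro k
    have : ∃ e, IsEssentialBelow e ⊤ ∧ ¬ x k ≤ e := by
      by_contra! hall
      exact hx0 k (le_bot_iff.1 (hinf ▸ le_sInf hall))
    obtain ⟨e, he, hne⟩ := this
    exact ⟨e ⊓ x k, inf_le_right, fun hle => hne (hle.trans inf_le_left), he.inf_of_top _⟩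
  choose e hex hnex hess_e using he
  have hpF : ∀ k, Disjoint (partialSups x k) (F (k + 1)) := by
    intro k
    induction k with
    | zero => simpa using hxd 0
    | succ k ih =>
      rw [partialSups_add_one]
      refine (hxd (k + 1)).disjoint_sup_left_of_disjoint_sup_right (ih.mono_right ?_)
      exact sup_le (hxF _) (hF (Nat.le_succ _))
  have hpe : ∀ k, IsEssentialBelow (partialSups e k) (partialSups x k) := by
    intro k
    induction k with
    | zero => simpa using hess_e 0
    | succ k ih =>
      rw [partialSups_add_one, partialSups_add_one]
      exact ih.sup (partialSups_mono hex k) (hess_e _) (hex _) ((hpF k).mono_right (hxF _))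
  have hE : IsEssentialBelow (⨆ k, e k) (⨆ k, x k) := by
    have := h.isEssentialBelow_iSup (partialSups_monotone x) hpe
    rwa [iSup_partialSups_eq, iSup_partialSups_eq] at this
  obtain ⟨c, hcd, hc⟩ := h.exists_disjoint_isEssentialBelow_sup (⨆ k, e k)
  have hcx : Disjoint c (⨆ k, x k) :=
    disjoint_iff.2 (hE _ inf_le_right (hcd.mono_left inf_le_left))
  -- each `x k` is independent of the other ones
  have hind : ∀ k, Disjoint (x k) (⨆ j, ⨆ _ : j ≠ k, x j) := by
    intro k
    have hle : ⨆ j, ⨆ _ : j ≠ k, x j ≤ (⨆ j, ⨆ _ : j < k, x j) ⊔ F (k + 1) := by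
      refine iSup₂_le fun j hj => ?_
      rcases lt_or_gt_of_ne hj with hlt | hgt
      · exact le_sup_of_le_left (le_iSup₂ (f := fun j (_ : j < k) => x j) j hlt)
      · exact le_sup_of_le_right ((hxF j).trans (hF hgt))
    refine Disjoint.mono_right hle ?_
    have h1 : Disjoint (⨆ j, ⨆ _ : j < k, x j) (F k) := by
      cases k with
      | zero => simp
      | succ k =>
        refine (hpF k).mono_left (iSup₂_le fun j hj => le_partialSups_of_le x (by omega))
    rw [sup_comm]
    exact (hxd k).disjoint_sup_right_of_disjoint_sup_left
      (h1.symm.mono_left (sup_le (hxF _) (hF (Nat.le_succ _))))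
  -- Over the essential element `(⨆ k, e k) ⊔ c`, the set `A` selects the indices at which `e j` is
  -- enlarged to `x j`. Independence recovers `A`, so the power set of `ℕ` embeds.
  let g : Set ℕ → Λ := fun A => ((⨆ k, e k) ⊔ c) ⊔ ⨆ j, ⨆ _ : j ∈ A, x j
  have hg : StrictMono g := by
    intro A B hAB
    obtain ⟨hsub, k, hkB, hkA⟩ := Set.ssubset_iff_exists.1 hAB
    have hle : g A ≤ g B := sup_le_sup_left (biSup_mono fun j hj => hsub hj) _
    refine hle.lt_of_not_ge fun hge => ?_
    have hxk : x k ≤ g A :=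
      (le_sup_of_le_right (le_iSup₂ (f := fun j (_ : j ∈ B) => x j) k hkB)).trans hge
    set Y := ⨆ j, ⨆ _ : j ≠ k, x j with hY
    have hgA : g A ≤ e k ⊔ (c ⊔ Y) := by
      refine sup_le (sup_le (iSup_le fun j => ?_) ?_) (iSup₂_le fun j hj => ?_)
      · by_cases hjk : j = k
        · subst hjk; exact le_sup_left
        · exact (hex j).trans (le_sup_of_le_right (le_sup_of_le_right
            (le_iSup₂ (f := fun j (_ : j ≠ k) => x j) j hjk)))
      · exact le_sup_of_le_right le_sup_left
      · exact le_sup_of_le_right (le_sup_of_le_right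
            (le_iSup₂ (f := fun j (_ : j ≠ k) => x j) j (fun h => hkA (h ▸ hj))))
    have hdis : Disjoint (x k) (c ⊔ Y) := by
      rw [sup_comm]
      refine (hind k).disjoint_sup_right_of_disjoint_sup_left (hcx.symm.mono_left ?_)
      exact sup_le (le_iSup x k) (iSup₂_le fun j _ => le_iSup x j)
    apply hnex k
    calc x k = (e k ⊔ (c ⊔ Y)) ⊓ x k := (inf_eq_right.2 (hxk.trans hgA)).symm
      _ = e k ⊔ (c ⊔ Y) ⊓ x k := sup_inf_assoc_of_le _ (hex k)
      _ = e k := by rw [hdis.symm.eq_bot, sup_bot_eq]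
      _ ≤ e k := le_rfl
  obtain ⟨enum, henum⟩ := exists_surjective_nat ℚ
  -- Lower cuts of an enumeration of `ℚ` form a copy of `ℚ` in that power set; the index of `p`
  -- separates the cuts at `p` and `q`.
  refine hess _ hc (fun q => ⟨g {n | enum n < q}, le_sup_left⟩) fun p q hpq => hg ?_
  refine Set.ssubset_iff_exists.2 ⟨fun n hn => lt_trans hn hpq, ?_⟩
  obtain ⟨n, rfl⟩ := henum p
  exact ⟨n, hpq, fun hn => lt_irrefl (enum n) hn⟩

/-- Some gap `[a, b]` of the copy of `ℚ` has `a` essential below `b`. With `c` a pseudocomplement of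
`b`, the element `a ⊔ c` is essential, and by modularity joining with `c` is injective on chains in
`[a, b]`. -/
theorem isScatteredOrder [IsModularLattice Λ] (h : IsUpperContinuous Λ)
    (hess : ∀ e : Λ, IsEssentialBelow e ⊤ → IsScatteredOrder (Set.Ici e))
    (hinf : sInf {e : Λ | IsEssentialBelow e ⊤} = ⊥) : IsScatteredOrder Λ := by
  intro f hf
  obtain ⟨m, hm⟩ := h.exists_isEssentialBelow_of_antitone hess hinf
    (f := fun n : ℕ => f (-(n : ℚ)))
    (fun i j hij => hf.monotone (neg_le_neg (by exact_mod_cast hij)))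
  have hlt : (-((m + 1 : ℕ) : ℚ)) < -(m : ℚ) := neg_lt_neg (by push_cast; linarith)
  obtain ⟨ψ, hψ, hψm⟩ := exists_strictMono_rat_between hlt
  set a := f (-((m + 1 : ℕ) : ℚ))
  set b := f (-(m : ℚ))
  have hab : a ≤ b := (hf hlt).le
  obtain ⟨c, hcd, hc⟩ := h.exists_disjoint_isEssentialBelow_sup b
  have hac : IsEssentialBelow (a ⊔ c) ⊤ :=
    ((hm _ m.le_succ).sup_right hab hcd.symm).trans hc
  refine hess _ hac (fun q => ⟨f (ψ q) ⊔ c, sup_le_sup_right (hf (hψm q).1).le _⟩) ?_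
  intro p q hpq
  have h0 := hf (hψ hpq)
  refine lt_of_le_of_ne (sup_le_sup_right h0.le c) fun he => ?_
  have he' : f (ψ p) ⊔ c = f (ψ q) ⊔ c := congrArg Subtype.val he
  refine h0.ne (eq_of_le_of_inf_le_of_sup_le h0.le (z := c) ?_ he'.ge)
  rw [(hcd.symm.mono_left (hf (hψm q).2).le).eq_bot]
  exact bot_le

end IsUpperContinuous

/-! ### `AB5*`, small submodules and duality. -/

theorem HasAB5Star.of_surjective {R : Type u} [Ring R] {X : Type*} [AddCommGroup X] [Module R X]
    {Y : Type*} [AddCommGroup Y] [Module R Y] (h : HasAB5Star R X) (φ : X →ₗ[R] Y)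
    (hφ : Function.Surjective φ) : HasAB5Star R Y := by
  intro N S hS
  have hdir : DirectedOn (· ≥ ·) (Submodule.comap φ '' S) := by
    rintro _ ⟨A, hA, rfl⟩ _ ⟨B, hB, rfl⟩
    obtain ⟨C, hC, hCA, hCB⟩ := hS A hA B hB
    exact ⟨_, ⟨C, hC, rfl⟩, Submodule.comap_mono hCA, Submodule.comap_mono hCB⟩
  have h1 := h (N.comap φ) _ hdir
  refine le_antisymm (le_iInf₂ fun A hA => sup_le_sup_left (sInf_le hA) _) fun y hy => ?_
  obtain ⟨x, rfl⟩ := hφ y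
  have hx : x ∈ N.comap φ ⊔ sInf (Submodule.comap φ '' S) := by
    rw [h1]
    simp only [Submodule.mem_iInf, Set.forall_mem_image] at hy ⊢
    intro A hA
    obtain ⟨n, hn, a, ha, hna⟩ := Submodule.mem_sup.1 (hy A hA)
    obtain ⟨n, rfl⟩ := hφ n
    refine Submodule.mem_sup.2 ⟨n, hn, x - n, ?_, add_sub_cancel _ _⟩
    rw [Submodule.mem_comap, map_sub, ← hna, add_sub_cancel_left]
    exact ha
  obtain ⟨n, hn, a, ha, rfl⟩ := Submodule.mem_sup.1 hx
  rw [map_add]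
  refine Submodule.add_mem_sup hn ?_
  rw [Submodule.mem_sInf] at ha ⊢
  exact fun A hA => ha _ ⟨A, hA, rfl⟩

theorem HasAB5Star.isUpperContinuous {R : Type u} [Ring R] {X : Type*} [AddCommGroup X]
    [Module R X] (h : HasAB5Star R X) : IsUpperContinuous (Submodule R X)ᵒᵈ := fun N S hS =>
  h (OrderDual.ofDual N) (OrderDual.toDual ⁻¹' S) hS

theorem isEssentialBelow_toDual_iff {R : Type u} [Ring R] {X : Type*} [AddCommGroup X]
    [Module R X] {N : Submodule R X} :
    IsEssentialBelow (OrderDual.toDual N) ⊤ ↔ IsSmallSubmodule N := by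
  constructor
  · intro h K hK
    exact h (OrderDual.toDual K) le_top
      (disjoint_toDual_iff.2 (codisjoint_iff.2 (by rw [sup_comm]; exact hK)))
  · intro h y _ hd
    have := codisjoint_iff.1
      (show Codisjoint (OrderDual.ofDual y) N from disjoint_toDual_iff.1 hd)
    exact h (OrderDual.ofDual y) (by rw [sup_comm]; exact this)

/-- An `AB5*` module which is the sum of its small submodules has a scattered submodule lattice as
soon as all its small submodules have one. -/
theorem HasAB5Star.isScatteredOrder_of_moduleRad_eq_top {R : Type u} [Ring R] {X : Type*}
    [AddCommGroup X] [Module R X] (h : HasAB5Star R X)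
    (hsmall : ∀ N : Submodule R X, IsSmallSubmodule N → IsScatteredOrder (Set.Iic N))
    (hrad : moduleRad R X = ⊤) : IsScatteredOrder (Submodule R X) := by
  refine IsScatteredOrder.of_dual (h.isUpperContinuous.isScatteredOrder (fun e he => ?_) ?_)
  · have := hsmall (OrderDual.ofDual e) (isEssentialBelow_toDual_iff.1 he)
    refine IsScatteredOrder.of_dual (this.of_strictMono
      (g := fun x => ⟨OrderDual.ofDual (OrderDual.ofDual x).1, (OrderDual.ofDual x).2⟩) ?_)
    exact fun x y hxy => hxy
  · refine (congrArg sInf (Set.ext fun e => ?_)).trans (congrArg OrderDual.toDual hrad)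
    exact isEssentialBelow_toDual_iff (N := OrderDual.ofDual e)

theorem IsSmallSubmodule.map {R : Type u} [Ring R] {X : Type*} [AddCommGroup X] [Module R X]
    {Y : Type*} [AddCommGroup Y] [Module R Y] {N : Submodule R X} (h : IsSmallSubmodule N)
    (φ : X →ₗ[R] Y) : IsSmallSubmodule (N.map φ) := by
  intro K hK
  have h1 : N ⊔ K.comap φ = ⊤ := by
    refine eq_top_iff.2 fun x _ => ?_
    have hx : φ x ∈ N.map φ ⊔ K := hK ▸ Submodule.mem_top
    obtain ⟨_, ⟨n, hn, rfl⟩, k, hk, hnk⟩ := Submodule.mem_sup.1 hx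
    refine Submodule.mem_sup.2 ⟨n, hn, x - n, ?_, add_sub_cancel _ _⟩
    rw [Submodule.mem_comap, map_sub, ← hnk, add_sub_cancel_left]
    exact hk
  have h2 := h _ h1
  rw [← hK, eq_comm, sup_eq_right]
  exact Submodule.map_le_iff_le_comap.2 (h2 ▸ le_top)

theorem moduleRad_eq_top_of_map_eq_top {R : Type u} [Ring R] {X : Type*} [AddCommGroup X]
    [Module R X] {Y : Type*} [AddCommGroup Y] [Module R Y] (φ : X →ₗ[R] Y)
    (h : (moduleRad R X).map φ = ⊤) : moduleRad R Y = ⊤ := by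
  rw [eq_top_iff, ← h, Submodule.map_le_iff_le_comap]
  refine sSup_le fun N hN => ?_
  rw [← Submodule.map_le_iff_le_comap]
  exact le_sSup (IsSmallSubmodule.map hN φ)

/-! ### Weak supplements and the main theorem. -/

theorem IsWeakSupplement.map_mkQ_eq_top {R : Type u} [Ring R] {M : Type v} [AddCommGroup M]
    [Module R M] {K L : Submodule R M} (h : IsWeakSupplement K L) : L.map K.mkQ = ⊤ := by
  rw [Submodule.map_mkQ_eq_top, h.1]

/-- Small submodules of `M ⧸ K` lift to small submodules of a submodule `L` of which `K` is a weak
supplement. -/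
theorem IsWeakSupplement.isSmallSubmodule_comap_inf {R : Type u} [Ring R] {M : Type v}
    [AddCommGroup M] [Module R M] {K L : Submodule R M} (h : IsWeakSupplement K L)
    {T : Submodule R (M ⧸ K)} (hT : IsSmallSubmodule T) :
    IsSmallSubmodule (T.comap K.mkQ ⊓ L) := by
  intro X hX
  apply h.2
  set P := K ⊓ L
  set N := T.comap K.mkQ ⊓ L
  -- Modularity splits `L` along `N`; modulo `K` the part from `N` lands in the small `T` and can be
  -- dropped, giving `L ≤ P ⊔ X`.
  have hN : N ⊔ (P ⊔ X) ⊓ L = L := by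
    rw [← sup_inf_assoc_of_le _ (inf_le_right : N ≤ L), inf_eq_right,
      show N ⊔ (P ⊔ X) = ⊤ from eq_top_iff.2 (hX ▸ sup_le_sup_left le_sup_right _)]
    exact le_top
  have hmap : ((P ⊔ X) ⊓ L).map K.mkQ = ⊤ := by
    apply hT
    rw [eq_top_iff, ← h.map_mkQ_eq_top]
    conv_lhs => rw [← hN, Submodule.map_sup]
    exact sup_le_sup_right (Submodule.map_le_iff_le_comap.2 inf_le_left) _
  rw [Submodule.map_mkQ_eq_top] at hmap
  have hL : L ≤ (P ⊔ X) ⊓ L := by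
    have h1 : ((P ⊔ X) ⊓ L ⊔ K) ⊓ L = (P ⊔ X) ⊓ L ⊔ K ⊓ L :=
      sup_inf_assoc_of_le _ inf_le_right
    rw [sup_comm _ K, hmap, top_inf_eq] at h1
    exact h1.le.trans (sup_le le_rfl (le_inf le_sup_left inf_le_right))
  rw [eq_top_iff, ← hX]
  exact sup_le (inf_le_right.trans (hL.trans inf_le_left)) le_sup_right

theorem HasKrullDim.isScatteredOrder_Iic {R : Type u} [Ring R] {M : Type v} [AddCommGroup M]
    [Module R M] {N : Submodule R M} (h : HasKrullDim R N) : IsScatteredOrder (Set.Iic N) := by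
  refine (hasKrullDim_iff_isScatteredOrder.1 h).of_strictMono
    (g := fun x => x.1.submoduleOf N) fun x y hxy => ?_
  refine lt_of_le_of_ne (Submodule.comap_mono hxy.le) fun e => hxy.ne (Subtype.ext ?_)
  have h2 := congrArg (Submodule.map N.subtype) e
  simp only [Submodule.submoduleOf, Submodule.map_comap_subtype] at h2
  rwa [inf_eq_right.2 x.2, inf_eq_right.2 y.2] at h2

theorem corollary8 {R : Type u} [Ring R] {M : Type v} [AddCommGroup M] [Module R M]
    (hAB : HasAB5Star R (moduleRad R M))
    (hsmall : ∀ N : Submodule R M, IsSmallSubmodule N → HasKrullDim R N)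
    (L : Submodule R M) (hL : L ≤ moduleRad R M)
    (hsupp : ∃ K : Submodule R M, IsWeakSupplement K L) :
    HasKrullDim R L := by
  obtain ⟨K, hK⟩ := hsupp
  have htop : (moduleRad R M).map K.mkQ = ⊤ :=
    eq_top_iff.2 (hK.map_mkQ_eq_top ▸ Submodule.map_mono hL)
  have hABQ : HasAB5Star R (M ⧸ K) := by
    refine hAB.of_surjective (K.mkQ.comp (moduleRad R M).subtype) (LinearMap.range_eq_top.1 ?_)
    rw [LinearMap.range_comp, Submodule.range_subtype, htop]
  have hQ : IsScatteredOrder (Submodule R (M ⧸ K)) := by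
    refine hABQ.isScatteredOrder_of_moduleRad_eq_top (fun T hT => ?_)
      (moduleRad_eq_top_of_map_eq_top K.mkQ htop)
    refine (hsmall _ (hK.isSmallSubmodule_comap_inf hT)).isScatteredOrder_Iic.of_strictMono
      (g := fun S => ⟨S.1.comap K.mkQ ⊓ L, inf_le_inf_right _ (Submodule.comap_mono S.2)⟩) ?_
    intro S S' hS
    refine lt_of_le_of_ne (inf_le_inf_right L (Submodule.comap_mono hS.le)) fun e => ?_
    -- Since `K ⊔ L = ⊤`, a submodule containing `K` is recovered from its trace on `L`.
    have key : ∀ U : Submodule R (M ⧸ K), K ⊔ U.comap K.mkQ ⊓ L = U.comap K.mkQ := by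
      intro U
      rw [inf_comm, ← sup_inf_assoc_of_le L (Submodule.le_comap_mkQ K U), hK.1, top_inf_eq]
    have h1 : S.1.comap K.mkQ ⊓ L = S'.1.comap K.mkQ ⊓ L := congrArg Subtype.val e
    have h2 : S.1.comap K.mkQ = S'.1.comap K.mkQ := by rw [← key, h1, key]
    exact hS.ne (Subtype.ext
      (Submodule.comap_injective_of_surjective (Submodule.mkQ_surjective K) h2))
  refine hasKrullDim_of_isScatteredOrder (IsScatteredOrder.of_monotone_pair
    (hsmall _ hK.2).isScatteredOrder_Iic hQ
    (g := fun U : Submodule R L => ⟨K ⊓ U.map L.subtype,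
      inf_le_inf_left _ (Submodule.map_subtype_le _ _)⟩)
    (k := fun U => (U.map L.subtype).map K.mkQ)
    (fun U V hUV => inf_le_inf_left K (Submodule.map_mono hUV))
    (fun U V hUV => Submodule.map_mono (Submodule.map_mono hUV)) ?_)
  intro U V hUV h1 h2
  apply Submodule.map_injective_of_injective L.injective_subtype
  -- Modular law: comparable submodules with the same meet and join with `K` coincide.
  refine eq_of_le_of_inf_le_of_sup_le (Submodule.map_mono hUV) (z := K) ?_ ?_
  · rw [inf_comm _ K, inf_comm _ K]
    exact (congrArg Subtype.val h1).ge
  · have h3 := congrArg (Submodule.comap K.mkQ) h2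
    simp only [Submodule.comap_map_mkQ] at h3
    rw [sup_comm _ K, sup_comm _ K]
    exact h3.ge
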